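/- There is an absolute constant $c>0$ such that for every dimension $d\ge 2$, every $\varepsilon\in(0,1/2)$ and every quantum query algorithm $\mathcal A$ that estimates the trace distance between two pure states in $\mathbb C^d$ to within additive error $\varepsilon$ with probability at least $2/3$, the query complexity $Q$ of $\mathcal A$ satisfies $Q\ge c/\varepsilon$ (that is, $Q=\Omega(1/\varepsilon)$). Here the trace distance between pure states $|\varphi\rangle,|\psi\rangle$ is $\mathrm T(|\varphi\rangle,|\psi\rangle)=\tfrac12\operatorname{tr}\bigl|\,|\varphi\rangle\langle\varphi|-|\psi\rangle\langle\psi|\,\bigr|$. The states are given through unitary state-preparation oracles $U,V$ on $\mathbb C^d$ with $U|0\rangle=|\varphi\rangle$ and $V|0\rangle=|\psi\rangle$. A quantum query algorithm with query complexity $Q$ acts on a $d$-dimensional register together with finitely many ancilla qubits, and is a circuit $\mathcal A^{U,V}=G_Q\,U_Q\cdots G_1\,U_1\,G_0$, where the $G_j$ are unitaries that do not depend on the oracles and each $U_j$ is one query, namely one of $U,U^\dagger,V,V^\dagger$ applied to the $d$-dimensional register, possibly controlled on an ancilla qubit. The state $\mathcal A^{U,V}|0\rangle$ is measured in the computational basis,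 and a real number $\tilde x$ determined by the measurement outcome is output. The algorithm estimates the trace distance to within additive error $\varepsilon$ with probability at least $2/3$ if, for all pure states $|\varphi\rangle,|\psi\rangle\in\mathbb C^d$ and all oracles $U,V$ preparing them, $\Pr\bigl[\,|\tilde x-\mathrm T(|\varphi\rangle,|\psi\rangle)|\le\varepsilon\,\bigr]\ge 2/3$. -/

import Mathlib

open scoped Matrix

noncomputable section

namespace QuantumQuery

/-- The trace norm `‖M‖₁ = tr √(Mᴴ M)`: the sum of the singular values of `M`, i.e. of the square
roots of the eigenvalues (with multiplicity) of `Mᴴ M`. -/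
def traceNorm {n : Type*} [Fintype n] [DecidableEq n] (M : Matrix n n ℂ) : ℝ :=
  ∑ i, √((Matrix.isHermitian_conjTranspose_mul_self M).eigenvalues i)

/-- The rank-one operator `|φ⟩⟨φ|`. -/
def pureDensity {n : Type*} (φ : n → ℂ) : Matrix n n ℂ :=
  Matrix.vecMulVec φ (star φ)

/-- The trace distance `½ ‖ |φ⟩⟨φ| - |ψ⟩⟨ψ| ‖₁` between two pure states. -/
def traceDistance {n : Type*} [Fintype n] [DecidableEq n] (φ ψ : n → ℂ) : ℝ :=
  traceNorm (pureDensity φ - pureDensity ψ) / 2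

/-- The unitary oracle `U` on `ℂ^d` is a state-preparation oracle for `|φ⟩`: `U |0⟩ = |φ⟩`.
Since `U` is unitary, `φ` is then a unit vector. -/
def Prepares {d : ℕ} [NeZero d] (U : Matrix.unitaryGroup (Fin d) ℂ) (φ : Fin d → ℂ) : Prop :=
  (U : Matrix (Fin d) (Fin d) ℂ) *ᵥ Pi.single 0 1 = φ

/-- The computational basis of the workspace: one register of dimension `d`, on which the oracles
act, together with `a` ancilla qubits. -/
abbrev Workspace (d a : ℕ) : Type := Fin d × (Fin a → Fin 2)

/-- Which of the two oracles is queried. -/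
inductive OracleName
  | first
  | second

/-- One oracle query: which oracle is called, whether its inverse is used, and, for a controlled
query, which ancilla qubit is the control (`none` is an uncontrolled query). -/
structure Query (a : ℕ) where
  oracle : OracleName
  inverse : Bool
  control : Option (Fin a)

/-- The operator on `ℂ^d` called by a query when the oracles are `U` and `V`: one of
`U`, `Uᴴ`, `V`, `Vᴴ`. -/
def Query.called {d a : ℕ} (q : Query a) (U V : Matrix.unitaryGroup (Fin d) ℂ) :
    Matrix (Fin d) (Fin d) ℂ :=
  let W : Matrix (Fin d) (Fin d) ℂ :=
    match q.oracle with
    | .first => U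
    | .second => V
  if q.inverse then Wᴴ else W

/-- Whether the query fires when the ancilla qubits are in the basis state `w`: always if it is
uncontrolled, and exactly when the control qubit is `1` if it is controlled. -/
def Query.Active {a : ℕ} (q : Query a) (w : Fin a → Fin 2) : Prop :=
  ∀ c ∈ q.control, w c = 1

open Classical in
/-- The operator on the whole workspace performed by a query. It is block diagonal with respect to
the basis of the ancilla qubits: `∑ w, (if active at w then W else 1) ⊗ |w⟩⟨w|`. -/
def Query.operator {d a : ℕ} (q : Query a) (U V : Matrix.unitaryGroup (Fin d) ℂ) :
    Matrix (Workspace d a) (Workspace d a) ℂ :=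
  Matrix.blockDiagonal fun w => if q.Active w then q.called U V else 1

/-- A quantum query algorithm with access to two unitary oracles on `ℂ^d` (and to their inverses
and controlled versions): the circuit `G_Q · U_Q ⋯ G_1 · U_1 · G_0`, where each `G_j` is a unitary
on the workspace that does not depend on the oracles and each `U_j` is a query. The pair
`(U_j, G_j)` is the `j`-th entry of `steps`. At the end the workspace is measured in the
computational basis, and the real number `output x` is returned on the outcome `x`
(measuring only some of the qubits is the case where `output` ignores the others).
An oracle is always called on the first register; calling it on other qubits amounts to
swapping registers, which the gates can do. -/
structure Algorithm (d : ℕ) where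
  ancillas : ℕ
  initialGate : Matrix.unitaryGroup (Workspace d ancillas) ℂ
  steps : List (Query ancillas × Matrix.unitaryGroup (Workspace d ancillas) ℂ)
  output : Workspace d ancillas → ℝ

namespace Algorithm

/-- The query complexity `Q`: the number of oracle calls in the circuit. -/
def queryComplexity {d : ℕ} (A : Algorithm d) : ℕ := A.steps.length

/-- The state before the measurement, `G_Q U_Q ⋯ G_1 U_1 G_0 |0⟩`, when the oracles
are `U` and `V`. -/
def finalState {d : ℕ} [NeZero d] (A : Algorithm d) (U V : Matrix.unitaryGroup (Fin d) ℂ) :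
    Workspace d A.ancillas → ℂ :=
  A.steps.foldl
    (fun v s => (s.2 : Matrix (Workspace d A.ancillas) (Workspace d A.ancillas) ℂ) *ᵥ
      (s.1.operator U V *ᵥ v))
    ((A.initialGate : Matrix (Workspace d A.ancillas) (Workspace d A.ancillas) ℂ) *ᵥ
      Pi.single (0, fun _ => 0) 1)

open Classical in
/-- The probability that the returned real number lies in `S`, when the oracles
are `U` and `V`. -/
def outputProb {d : ℕ} [NeZero d] (A : Algorithm d) (U V : Matrix.unitaryGroup (Fin d) ℂ)
    (S : Set ℝ) : ℝ :=
  ∑ x with A.output x ∈ S, ‖A.finalState U V x‖ ^ 2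

/-- `A` estimates the trace distance between two pure states in `ℂ^d` to within additive
error `ε` with probability at least `p`, whatever the states are and whatever oracles prepare
them. -/
def EstimatesTraceDistance {d : ℕ} [NeZero d] (A : Algorithm d) (ε p : ℝ) : Prop :=
  ∀ (φ ψ : Fin d → ℂ) (U V : Matrix.unitaryGroup (Fin d) ℂ), Prepares U φ → Prepares V ψ →
    p ≤ A.outputProb U V {r | |r - traceDistance φ ψ| ≤ ε}

end Algorithm

end QuantumQuery

end

/-! The adversary keeps the first oracle trivial and takes the second to be either the identity or a
rotation of a coordinate plane with sine `s`. The trace distances are then 0 and `s`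
(`traceDistance_single_planeRot`), so for `2ε < s` no single output is correct in both cases. Yet
one query distinguishes the two cases only by an operator of norm O(`s`)
(`Query.norm_operator_sub_le`). By the hybrid argument (`norm_foldl_steps_sub_le`) these errors add,
so the final states are O(`Q s`) apart, and so are their outcome probabilities
(`sum_norm_sq_sub_le`). Success probability 2/3 in both cases needs a constant gap, and taking `s`
of order `ε` gives `Q = Ω(1/ε)`. -/

open scoped Matrix.Norms.L2Operator

namespace QuantumQuery

/-! ### Rotations of a coordinate plane. -/

section PlaneRotation

variable {n : Type*} [DecidableEq n]

/-- The projection onto the coordinate plane spanned by the basis vectors `i` and `j`. -/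
def planeProj (i j : n) : Matrix n n ℂ :=
  Matrix.single i i 1 + Matrix.single j j 1

/-- The generator of the rotations of the coordinate plane of `i` and `j`. -/
def planeGen (i j : n) : Matrix n n ℂ :=
  Matrix.single j i 1 - Matrix.single i j 1

/-- The rotation with cosine `c` and sine `s` in the coordinate plane of `i` and `j`. -/
def planeRot (i j : n) (c s : ℝ) : Matrix n n ℂ :=
  1 + (((c : ℂ) - 1) • planeProj i j + (s : ℂ) • planeGen i j)

lemma planeProj_conjTranspose (i j : n) : (planeProj i j)ᴴ = planeProj i j := by
  simp [planeProj, Matrix.conjTranspose_single]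

lemma planeGen_conjTranspose (i j : n) : (planeGen i j)ᴴ = -planeGen i j := by
  simp [planeGen, Matrix.conjTranspose_single]

lemma planeRot_conjTranspose (i j : n) (c s : ℝ) :
    (planeRot i j c s)ᴴ = planeRot i j c (-s) := by
  simp [planeRot, planeProj_conjTranspose, planeGen_conjTranspose]

variable [Fintype n]

lemma planeProj_mul_self {i j : n} (h : i ≠ j) :
    planeProj i j * planeProj i j = planeProj i j := by
  simp [planeProj, mul_add, add_mul, h, h.symm]

lemma planeProj_mul_planeGen {i j : n} (h : i ≠ j) :
    planeProj i j * planeGen i j = planeGen i j := by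
  simp [planeProj, planeGen, mul_sub, add_mul, h, h.symm]

lemma planeGen_mul_planeProj {i j : n} (h : i ≠ j) :
    planeGen i j * planeProj i j = planeGen i j := by
  simp [planeProj, planeGen, mul_add, sub_mul, h, h.symm, ← sub_eq_add_neg]

lemma planeGen_mul_self {i j : n} (h : i ≠ j) :
    planeGen i j * planeGen i j = -planeProj i j := by
  simp [planeProj, planeGen, mul_sub, sub_mul, h, h.symm]
  abel

/-- On the plane the generator squares to `-1`, so the mixed terms cancel and the factor is `(c -
1)² + s²`. This yields both unitarity and the distance of the rotation from the identity. -/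
lemma planeRot_sub_one_conjTranspose_mul_self {i j : n} (h : i ≠ j) {c s : ℝ}
    (hcs : c ^ 2 + s ^ 2 = 1) :
    (planeRot i j c s - 1)ᴴ * (planeRot i j c s - 1) = ((2 - 2 * c : ℝ) : ℂ) • planeProj i j := by
  have hcs' : (s : ℂ) * s = 1 - c * c := by
    rw [eq_sub_iff_add_eq]
    exact_mod_cast (by linarith : s * s + c * c = 1)
  rw [Matrix.conjTranspose_sub, planeRot_conjTranspose]
  simp only [planeRot, Matrix.conjTranspose_one, add_sub_cancel_left, add_mul, mul_add,
    Matrix.smul_mul, Matrix.mul_smul, planeProj_mul_self h, planeProj_mul_planeGen h,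
    planeGen_mul_planeProj h, planeGen_mul_self h, smul_smul, smul_neg]
  push_cast
  match_scalars
  · linear_combination hcs'
  · ring

lemma planeRot_mem_unitaryGroup {i j : n} (h : i ≠ j) {c s : ℝ} (hcs : c ^ 2 + s ^ 2 = 1) :
    planeRot i j c s ∈ Matrix.unitaryGroup n ℂ := by
  rw [Matrix.mem_unitaryGroup_iff', Matrix.star_eq_conjTranspose]
  have key := planeRot_sub_one_conjTranspose_mul_self h hcs
  have hsum : planeRot i j c s + (planeRot i j c s)ᴴ
      = 2 - ((2 - 2 * c : ℝ) : ℂ) • planeProj i j := by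
    rw [planeRot_conjTranspose]
    simp only [planeRot]
    have h2 : (2 : Matrix n n ℂ) = 1 + 1 := one_add_one_eq_two.symm
    rw [h2]
    push_cast
    module
  calc (planeRot i j c s)ᴴ * planeRot i j c s
      = (planeRot i j c s - 1)ᴴ * (planeRot i j c s - 1)
        + (planeRot i j c s + (planeRot i j c s)ᴴ) - 1 := by
        rw [Matrix.conjTranspose_sub, Matrix.conjTranspose_one]; noncomm_ring
    _ = 1 := by
        rw [key, hsum, add_sub_cancel, ← one_add_one_eq_two, add_sub_cancel_right]

lemma planeRot_mulVec_single {i j : n} (h : i ≠ j) (c s : ℝ) :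
    planeRot i j c s *ᵥ Pi.single i 1 = Pi.single i (c : ℂ) + Pi.single j (s : ℂ) := by
  ext k
  rw [Matrix.mulVec_single_one]
  simp only [planeRot, planeProj, planeGen, Matrix.col_apply, Matrix.add_apply, Matrix.smul_apply,
    Matrix.sub_apply, Matrix.single_apply, Matrix.one_apply, Pi.add_apply, Pi.single_apply]
  by_cases hi : k = i
  · subst hi; simp [h, h.symm]
  · by_cases hj : k = j
    · subst hj; simp [h, h.symm]
    · simp [hi, hj, Ne.symm hi, Ne.symm hj]

end PlaneRotation

/-! ### Trace distance of two vectors in a plane. -/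

section TraceNorm

variable {n : Type*} [Fintype n] [DecidableEq n]

/-- If `Mᴴ M` is `t²` times a projection, then the trace norm of `M` is `tr (Mᴴ M) / t`. -/
lemma mul_traceNorm_eq_trace {M : Matrix n n ℂ} {t : ℝ} (ht : 0 ≤ t)
    (h : (Mᴴ * M) * (Mᴴ * M) = ((t ^ 2 : ℝ) : ℂ) • (Mᴴ * M)) :
    ((t * traceNorm M : ℝ) : ℂ) = (Mᴴ * M).trace := by
  have hH := Matrix.isHermitian_conjTranspose_mul_self M
  rw [hH.trace_eq_sum_eigenvalues, traceNorm, Finset.mul_sum, Complex.ofReal_sum]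
  refine Finset.sum_congr rfl fun k _ => ?_
  congr 1
  set v : n → ℂ := ⇑(hH.eigenvectorBasis k) with hv
  have hv0 : v ≠ 0 := by
    intro h0
    refine hH.eigenvectorBasis.orthonormal.ne_zero k ?_
    ext x
    exact congrFun h0 x
  have hev := hH.mulVec_eigenvectorBasis k
  rw [← hv] at hev
  have h2 := congrArg (fun N => N *ᵥ v) h
  simp only [← Matrix.mulVec_mulVec, hev, Matrix.smul_mulVec, Matrix.mulVec_smul] at h2
  obtain ⟨x, hx⟩ := Function.ne_iff.mp hv0
  have h3 := congrFun h2 x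
  simp only [Pi.smul_apply, Complex.real_smul, smul_eq_mul, ← mul_assoc] at h3
  -- Each eigenvalue `λ` is thus 0 or `t²`, and in both cases `t √λ = λ`.
  have h4 : hH.eigenvalues k * hH.eigenvalues k = t ^ 2 * hH.eigenvalues k := by
    exact_mod_cast mul_right_cancel₀ hx h3
  rcases eq_or_ne (hH.eigenvalues k) 0 with h0 | h0
  · simp [h0]
  · rw [mul_right_cancel₀ h0 h4, Real.sqrt_sq ht, ← sq]
    rfl

lemma traceDistance_self (φ : n → ℂ) : traceDistance φ φ = 0 := by
  have := mul_traceNorm_eq_trace (M := (0 : Matrix n n ℂ)) zero_le_one (by simp)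
  rw [traceDistance, sub_self]
  simp only [one_mul, Matrix.mul_zero, Matrix.trace_zero, Complex.ofReal_eq_zero] at this
  simp [this]

/-- Two real unit vectors of a coordinate plane at an angle with sine `s` have trace distance `s`. -/
lemma traceDistance_single_planeRot {i j : n} (h : i ≠ j) {c s : ℝ}
    (hcs : c ^ 2 + s ^ 2 = 1) (hs : 0 < s) :
    traceDistance (Pi.single i 1) (planeRot i j c s *ᵥ Pi.single i 1) = s := by
  set M : Matrix n n ℂ :=
    pureDensity (Pi.single i 1) - pureDensity (planeRot i j c s *ᵥ Pi.single i 1) with hM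
  have hcs' : (c : ℂ) * c = 1 - s * s := by
    rw [eq_sub_iff_add_eq]
    exact_mod_cast (by linarith : c * c + s * s = 1)
  have hM' : M = ((s : ℂ) * s) • (Matrix.single i i 1 - Matrix.single j j 1)
      - ((c : ℂ) * s) • (Matrix.single i j 1 + Matrix.single j i 1) := by
    have hvv (k l : n) (x y : ℝ) :
        Matrix.vecMulVec (Pi.single k (x : ℂ)) (star (Pi.single l (y : ℂ)))
        = ((x : ℂ) * y) • Matrix.single k l (1 : ℂ) := by
      rw [Pi.star_single]
      ext a b
      simp only [Matrix.vecMulVec_apply, Matrix.smul_apply, Matrix.single_apply, Pi.single_apply,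
        RCLike.star_def, Complex.conj_ofReal, smul_eq_mul, ite_mul, mul_ite, mul_zero, zero_mul,
        ite_and, mul_one, eq_comm]
      split_ifs <;> rfl
    have h1 : (Pi.single i 1 : n → ℂ) = Pi.single i ((1 : ℝ) : ℂ) := by simp
    rw [hM, planeRot_mulVec_single h, pureDensity, pureDensity, star_add,
      Matrix.vecMulVec_add, Matrix.add_vecMulVec, Matrix.add_vecMulVec, h1]
    simp only [hvv, smul_sub, smul_add]
    push_cast
    match_scalars <;> first | linear_combination -hcs' | ring
  -- A traceless symmetric matrix on a plane has scalar square; here the scalar is `s⁴ + c²s² = s²`.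
  have hMM : Mᴴ * M = ((s ^ 2 : ℝ) : ℂ) • planeProj i j := by
    have hMH : Mᴴ = M := by
      rw [hM']
      simp [Matrix.conjTranspose_single, add_comm]
    rw [hMH, hM']
    simp only [planeProj, sub_mul, mul_sub, add_mul, mul_add, Matrix.smul_mul, Matrix.mul_smul,
      Matrix.single_mul_single_same, Matrix.single_mul_single_of_ne, ne_eq, h, h.symm,
      not_false_eq_true, smul_sub, smul_add, mul_one]
    push_cast
    match_scalars <;> first | linear_combination ((s : ℂ) * s) * hcs' | ring
  have key := mul_traceNorm_eq_trace hs.le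
    (by rw [hMM, Matrix.smul_mul, Matrix.mul_smul, planeProj_mul_self h])
  have htr : (Mᴴ * M).trace = ((s * (2 * s) : ℝ) : ℂ) := by
    rw [hMM]
    simp [planeProj]
    ring
  rw [htr] at key
  have := mul_left_cancel₀ hs.ne' (Complex.ofReal_injective key)
  rw [traceDistance, ← hM, this]
  ring

end TraceNorm

/-! ### Distance between query operators. -/

section Operators

variable {d a : ℕ}

lemma Query.called_mem_unitaryGroup (q : Query a) (U V : Matrix.unitaryGroup (Fin d) ℂ) :
    q.called U V ∈ Matrix.unitaryGroup (Fin d) ℂ := by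
  unfold Query.called
  rcases q with ⟨_ | _, _ | _, _⟩
  · exact U.2
  · exact Unitary.star_mem U.2
  · exact V.2
  · exact Unitary.star_mem V.2

lemma Query.operator_mem_unitaryGroup (q : Query a) (U V : Matrix.unitaryGroup (Fin d) ℂ) :
    q.operator U V ∈ Matrix.unitaryGroup (Workspace d a) ℂ := by
  rw [Matrix.mem_unitaryGroup_iff', Matrix.star_eq_conjTranspose, Query.operator,
    Matrix.blockDiagonal_conjTranspose, ← Matrix.blockDiagonal_mul, ← Matrix.blockDiagonal_one]
  congr 1
  ext1 w
  have := Matrix.mem_unitaryGroup_iff'.mp (q.called_mem_unitaryGroup U V)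
  rw [Matrix.star_eq_conjTranspose] at this
  split_ifs <;> simp [this]

/-- Replacing the trivial second oracle by a plane rotation with cosine `c` changes a query by at
most the chord `√(2 - 2c)` in operator norm. -/
lemma Query.norm_operator_sub_le (q : Query a) {i j : Fin d} (h : i ≠ j) {c s : ℝ}
    (hcs : c ^ 2 + s ^ 2 = 1) (hc : c ≤ 1) (V : Matrix.unitaryGroup (Fin d) ℂ)
    (hV : (V : Matrix (Fin d) (Fin d) ℂ) = planeRot i j c s) :
    ‖q.operator 1 V - q.operator 1 1‖ ≤ √(2 - 2 * c) := by
  classical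
  -- By the C*-identity it suffices that `DᴴD` is `2 - 2c` times a projection, `D` being the
  -- difference. For a query to the first oracle `D = 0`; otherwise the active blocks carry the
  -- plane projection.
  have hsq : ∃ p : Matrix (Workspace d a) (Workspace d a) ℂ, IsStarProjection p ∧
      (q.operator 1 V - q.operator 1 1)ᴴ * (q.operator 1 V - q.operator 1 1)
        = ((2 - 2 * c : ℝ) : ℂ) • p := by
    rcases q with ⟨_ | _, b, o⟩
    · exact ⟨0, .zero _, by simp [Query.operator, Query.called]⟩
    · set q : Query a := ⟨.second, b, o⟩ with hq
      refine ⟨Matrix.blockDiagonal fun w => if q.Active w then planeProj i j else 0, ⟨?_, ?_⟩, ?_⟩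
      · rw [IsIdempotentElem, ← Matrix.blockDiagonal_mul]
        congr 1
        ext1 w
        split_ifs <;> simp [planeProj_mul_self h]
      · rw [IsSelfAdjoint, Matrix.star_eq_conjTranspose, Matrix.blockDiagonal_conjTranspose]
        congr 1
        ext1 w
        split_ifs <;> simp [planeProj_conjTranspose]
      · have hcalled : (q.called 1 V - 1)ᴴ * (q.called 1 V - 1)
            = ((2 - 2 * c : ℝ) : ℂ) • planeProj i j := by
          cases b
          · simpa [hq, Query.called, hV] using planeRot_sub_one_conjTranspose_mul_self h hcs
          -- The inverse rotation has the same cosine, hence the same chord.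
          · have : q.called 1 V = planeRot i j c (-s) := by
              simp [hq, Query.called, hV, planeRot_conjTranspose]
            rw [this]
            exact planeRot_sub_one_conjTranspose_mul_self h (by simpa using hcs)
        have hone : q.called (1 : Matrix.unitaryGroup (Fin d) ℂ) 1 = 1 := by
          cases b <;> simp [hq, Query.called]
        rw [Query.operator, Query.operator, ← Matrix.blockDiagonal_sub,
          Matrix.blockDiagonal_conjTranspose, ← Matrix.blockDiagonal_mul,
          ← Matrix.blockDiagonal_smul]
        congr 1
        ext1 w
        simp only [Pi.sub_apply, Pi.smul_apply, hone]
        split_ifs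
        · exact hcalled
        · simp
  obtain ⟨p, hp, hpq⟩ := hsq
  refine Real.le_sqrt_of_sq_le ?_
  rw [sq, ← Matrix.l2_opNorm_conjTranspose_mul_self, hpq, norm_smul, Complex.norm_real,
    Real.norm_of_nonneg (by linarith)]
  exact mul_le_of_le_one_right (by linarith) hp.norm_le

end Operators

/-! ### Norms of states and probabilities of events. -/

section Euclidean

variable {n : Type*} [Fintype n] [DecidableEq n]

lemma norm_toLp_mulVec_le (M : Matrix n n ℂ) (v : n → ℂ) :
    ‖WithLp.toLp 2 (M *ᵥ v)‖ ≤ ‖M‖ * ‖WithLp.toLp 2 v‖ :=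
  Matrix.l2_opNorm_mulVec M (WithLp.toLp 2 v)

lemma norm_toLp_unitary_mulVec_le {M : Matrix n n ℂ} (hM : M ∈ Matrix.unitaryGroup n ℂ)
    (v : n → ℂ) : ‖WithLp.toLp 2 (M *ᵥ v)‖ ≤ ‖WithLp.toLp 2 v‖ := by
  -- On an empty index type a unitary has norm 0, not 1.
  cases isEmpty_or_nonempty n
  · rw [Subsingleton.elim (M *ᵥ v) v]
  · refine (norm_toLp_mulVec_le M v).trans ?_
    rw [CStarRing.norm_of_mem_unitary hM, one_mul]

/-- The probabilities of an event under two states of norm at most one differ by at most twice the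
distance of the states. -/
lemma sum_norm_sq_sub_le (v w : n → ℂ) (hv : ‖WithLp.toLp 2 v‖ ≤ 1) (hw : ‖WithLp.toLp 2 w‖ ≤ 1)
    (S : Finset n) :
    ∑ x ∈ S, ‖v x‖ ^ 2 - ∑ x ∈ S, ‖w x‖ ^ 2 ≤ 2 * ‖WithLp.toLp 2 (v - w)‖ := by
  have res (u : n → ℂ) : ∑ x ∈ S, ‖u x‖ ^ 2 =
      ‖WithLp.toLp 2 (fun x => if x ∈ S then u x else 0)‖ ^ 2 := by
    rw [EuclideanSpace.norm_sq_eq, ← Finset.sum_filter_add_sum_filter_not _ (· ∈ S)]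
    simp +contextual [apply_ite]
  have le (u : n → ℂ) : ‖WithLp.toLp 2 (fun x => if x ∈ S then u x else 0)‖
      ≤ ‖WithLp.toLp 2 u‖ := by
    refine le_of_sq_le_sq ?_ (norm_nonneg _)
    rw [← res, EuclideanSpace.norm_sq_eq]
    exact Finset.sum_le_univ_sum_of_nonneg fun _ => by positivity
  have hsub : ‖WithLp.toLp 2 (fun x => if x ∈ S then v x else 0)‖
      - ‖WithLp.toLp 2 (fun x => if x ∈ S then w x else 0)‖ ≤ ‖WithLp.toLp 2 (v - w)‖ := by
    refine (norm_sub_norm_le _ _).trans (le_of_eq_of_le ?_ (le (v - w)))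
    congr 1
    ext x
    by_cases hx : x ∈ S <;> simp [hx]
  rw [res, res]
  have hv' := (le v).trans hv
  have hw' := (le w).trans hw
  have h0 := norm_nonneg (WithLp.toLp 2 (v - w))
  -- Factor `a² - b² = (a - b)(a + b)` with `a + b ≤ 2`.
  nlinarith [norm_nonneg (WithLp.toLp 2 (fun x => if x ∈ S then v x else 0)),
    norm_nonneg (WithLp.toLp 2 (fun x => if x ∈ S then w x else 0))]

end Euclidean

/-! ### The hybrid argument and the resulting query bound. -/

section Hybrid

variable {d a : ℕ}

lemma norm_foldl_steps_le (U V : Matrix.unitaryGroup (Fin d) ℂ)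
    (l : List (Query a × Matrix.unitaryGroup (Workspace d a) ℂ)) (v : Workspace d a → ℂ) :
    ‖WithLp.toLp 2 (l.foldl (fun v s => (s.2 : Matrix (Workspace d a) (Workspace d a) ℂ) *ᵥ
      (s.1.operator U V *ᵥ v)) v)‖ ≤ ‖WithLp.toLp 2 v‖ := by
  induction l generalizing v with
  | nil => simp
  | cons s l ih =>
    exact (ih _).trans ((norm_toLp_unitary_mulVec_le s.2.2 _).trans
      (norm_toLp_unitary_mulVec_le (s.1.operator_mem_unitaryGroup U V) _))

/-- The hybrid argument: if each query changes by at most `δ` in operator norm when the oracles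
are exchanged, then the state after `k` queries changes by at most `k δ`. -/
lemma norm_foldl_steps_sub_le (U V U' V' : Matrix.unitaryGroup (Fin d) ℂ) {δ : ℝ}
    (hδ : ∀ q : Query a, ‖q.operator U V - q.operator U' V'‖ ≤ δ)
    (l : List (Query a × Matrix.unitaryGroup (Workspace d a) ℂ)) (v w : Workspace d a → ℂ)
    (hw : ‖WithLp.toLp 2 w‖ ≤ 1) :
    ‖WithLp.toLp 2 (l.foldl (fun v s => (s.2 : Matrix (Workspace d a) (Workspace d a) ℂ) *ᵥ
        (s.1.operator U V *ᵥ v)) v -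
      l.foldl (fun v s => (s.2 : Matrix (Workspace d a) (Workspace d a) ℂ) *ᵥ
        (s.1.operator U' V' *ᵥ v)) w)‖ ≤ ‖WithLp.toLp 2 (v - w)‖ + l.length * δ := by
  induction l generalizing v w with
  | nil => simp
  | cons s l ih =>
    have hstep : ‖WithLp.toLp 2 ((s.2 : Matrix (Workspace d a) (Workspace d a) ℂ) *ᵥ
        (s.1.operator U V *ᵥ v) - (s.2 : Matrix (Workspace d a) (Workspace d a) ℂ) *ᵥ
        (s.1.operator U' V' *ᵥ w))‖ ≤ ‖WithLp.toLp 2 (v - w)‖ + δ := by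
      rw [← Matrix.mulVec_sub]
      refine (norm_toLp_unitary_mulVec_le s.2.2 _).trans ?_
      -- The old error is carried along by a unitary; the new error acts on `w` alone, so only `w`
      -- needs a norm bound.
      have hsplit : s.1.operator U V *ᵥ v - s.1.operator U' V' *ᵥ w
          = s.1.operator U V *ᵥ (v - w) + (s.1.operator U V - s.1.operator U' V') *ᵥ w := by
        rw [Matrix.mulVec_sub, Matrix.sub_mulVec]; abel
      rw [hsplit, WithLp.toLp_add]
      refine (norm_add_le _ _).trans (add_le_add
        (norm_toLp_unitary_mulVec_le (s.1.operator_mem_unitaryGroup U V) _) ?_)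
      refine (norm_toLp_mulVec_le _ _).trans ((mul_le_of_le_one_right (norm_nonneg _) hw).trans ?_)
      exact hδ s.1
    have hw' := ((norm_toLp_unitary_mulVec_le s.2.2 _).trans
      (norm_toLp_unitary_mulVec_le (s.1.operator_mem_unitaryGroup U' V') w)).trans hw
    refine (ih _ _ hw').trans ?_
    simp only [List.length_cons, Nat.cast_add, Nat.cast_one]
    linarith

namespace Algorithm

variable [NeZero d] (A : Algorithm d)

lemma norm_initialState_le :
    ‖WithLp.toLp 2 ((A.initialGate : Matrix (Workspace d A.ancillas) (Workspace d A.ancillas) ℂ) *ᵥ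
      Pi.single (0, fun _ => 0) 1)‖ ≤ 1 := by
  refine (norm_toLp_unitary_mulVec_le A.initialGate.2 _).trans (le_of_eq ?_)
  rw [← sq_eq_sq₀ (norm_nonneg _) zero_le_one, EuclideanSpace.norm_sq_eq]
  simp [Pi.single_apply, apply_ite]

lemma norm_finalState_le (U V : Matrix.unitaryGroup (Fin d) ℂ) :
    ‖WithLp.toLp 2 (A.finalState U V)‖ ≤ 1 :=
  (norm_foldl_steps_le U V A.steps _).trans A.norm_initialState_le

lemma norm_finalState_sub_le (U V U' V' : Matrix.unitaryGroup (Fin d) ℂ) {δ : ℝ}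
    (hδ : ∀ q : Query A.ancillas, ‖q.operator U V - q.operator U' V'‖ ≤ δ) :
    ‖WithLp.toLp 2 (A.finalState U V - A.finalState U' V')‖ ≤ A.queryComplexity * δ := by
  refine (norm_foldl_steps_sub_le U V U' V' hδ A.steps _ _ A.norm_initialState_le).trans ?_
  rw [sub_self, WithLp.toLp_zero, norm_zero, zero_add]
  rfl

lemma outputProb_add_le_one (U V : Matrix.unitaryGroup (Fin d) ℂ) {S T : Set ℝ}
    (hST : Disjoint S T) : A.outputProb U V S + A.outputProb U V T ≤ 1 := by
  classical
  have hdis : Disjoint ({x | A.output x ∈ S} : Finset (Workspace d A.ancillas))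
      ({x | A.output x ∈ T} : Finset (Workspace d A.ancillas)) := by
    refine Finset.disjoint_filter.mpr fun x _ hS hT => ?_
    exact Set.disjoint_left.mp hST hS hT
  have h1 : ∑ x, ‖A.finalState U V x‖ ^ 2 ≤ 1 := by
    have h := A.norm_finalState_le U V
    have h2 := EuclideanSpace.norm_sq_eq (WithLp.toLp 2 (A.finalState U V))
    rw [← h2]
    exact pow_le_one₀ (norm_nonneg _) h
  refine le_trans ?_ h1
  unfold outputProb
  convert (Finset.sum_union hdis (f := fun x => ‖A.finalState U V x‖ ^ 2)).symm.trans_le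
    (Finset.sum_le_univ_sum_of_nonneg fun _ => by positivity)

/-- If the queries to two pairs of oracles with trace distances more than `2ε` apart are `δ`-close,
then an estimator with success probability `2/3` makes at least `1 / (6δ)` queries. -/
lemma EstimatesTraceDistance.one_le_queryComplexity {A : Algorithm d} {ε δ : ℝ}
    (hA : A.EstimatesTraceDistance ε (2 / 3)) {φ ψ φ' ψ' : Fin d → ℂ}
    {U V U' V' : Matrix.unitaryGroup (Fin d) ℂ} (hU : Prepares U φ) (hV : Prepares V ψ)
    (hU' : Prepares U' φ') (hV' : Prepares V' ψ')
    (hε : 2 * ε < |traceDistance φ ψ - traceDistance φ' ψ'|)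
    (hδ : ∀ q : Query A.ancillas, ‖q.operator U V - q.operator U' V'‖ ≤ δ) :
    1 ≤ 6 * (A.queryComplexity * δ) := by
  have h1 := hA φ ψ U V hU hV
  have h2 := hA φ' ψ' U' V' hU' hV'
  have hdis : Disjoint {r : ℝ | |r - traceDistance φ ψ| ≤ ε}
      {r : ℝ | |r - traceDistance φ' ψ'| ≤ ε} := by
    refine Set.disjoint_left.mpr fun r hr hr' => ?_
    simp only [Set.mem_ofPred_eq] at hr hr'
    have := abs_sub_le (traceDistance φ ψ) r (traceDistance φ' ψ')
    rw [abs_sub_comm (traceDistance φ ψ) r] at this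
    linarith
  have h3 := A.outputProb_add_le_one U' V' hdis
  have h4 := A.norm_finalState_sub_le U V U' V' hδ
  have h5 : A.outputProb U V {r | |r - traceDistance φ ψ| ≤ ε}
      - A.outputProb U' V' {r | |r - traceDistance φ ψ| ≤ ε}
        ≤ 2 * ‖WithLp.toLp 2 (A.finalState U V - A.finalState U' V')‖ :=
    sum_norm_sq_sub_le _ _ (A.norm_finalState_le U V) (A.norm_finalState_le U' V') _
  -- The first event has probability at least 2/3 under `U, V` and at most 1/3 under `U', V'`, so
  -- `1/3 ≤ 2Qδ`.
  linarith

end Algorithm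

end Hybrid

end QuantumQuery

/-! ### The lower bound. -/

open QuantumQuery in
theorem theorem5p2 :
    ∃ c : ℝ, 0 < c ∧
      ∀ (d : ℕ) [NeZero d], 2 ≤ d →
        ∀ ε : ℝ, 0 < ε → ε < 1 / 2 →
          ∀ A : QuantumQuery.Algorithm d, A.EstimatesTraceDistance ε (2 / 3) →
            c / ε ≤ (A.queryComplexity : ℝ) := by
  refine ⟨1 / 48, by norm_num, fun d _ hd ε hε hε2 A hA => ?_⟩
  -- Since `s = 1 - (1 - 2ε)²`, it is a valid sine with `2ε < s ≤ 4ε` on all of `0 < ε < 1/2`; a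
  -- fixed multiple of `ε` above `2ε` would exceed 1 near `ε = 1/2`.
  set s : ℝ := 4 * ε * (1 - ε) with hs
  have hs0 : 0 < s := by rw [hs]; exact mul_pos (by linarith) (by linarith)
  have hs1 : s ≤ 1 := by rw [hs]; nlinarith [sq_nonneg (1 - 2 * ε)]
  have hsε : 2 * ε < s := by rw [hs]; nlinarith
  have hsε4 : s ≤ 4 * ε := by rw [hs]; nlinarith
  set c : ℝ := √(1 - s ^ 2) with hc
  have hcsq : c ^ 2 = 1 - s ^ 2 := Real.sq_sqrt (by nlinarith)
  have hcs : c ^ 2 + s ^ 2 = 1 := by rw [hcsq]; ring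
  have hc0 : 0 ≤ c := Real.sqrt_nonneg _
  have hc1 : c ≤ 1 := by nlinarith
  -- From `0 ≤ c ≤ 1`: `1 - c ≤ 1 - c² = s²`.
  have hδ : √(2 - 2 * c) ≤ 2 * s := Real.sqrt_le_iff.mpr ⟨by linarith, by nlinarith⟩
  set j : Fin d := ⟨1, by omega⟩
  have h01 : (0 : Fin d) ≠ j := by
    rw [Ne, Fin.ext_iff]
    simp [j]
  set V : Matrix.unitaryGroup (Fin d) ℂ :=
    ⟨planeRot 0 j c s, planeRot_mem_unitaryGroup h01 hcs⟩ with hV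
  have hone : Prepares (1 : Matrix.unitaryGroup (Fin d) ℂ) (Pi.single 0 1) := by
    rw [Prepares, OneMemClass.coe_one, Matrix.one_mulVec]
  have key := hA.one_le_queryComplexity (U := 1) (V := V) (U' := 1) (V' := 1) hone rfl hone hone
    (δ := 2 * s) (by
      rw [traceDistance_self, hV, traceDistance_single_planeRot h01 hcs hs0, sub_zero,
        abs_of_pos hs0]
      exact hsε)
    (fun q => (q.norm_operator_sub_le h01 hcs hc1 V rfl).trans hδ)
  rw [div_le_iff₀ hε]
  have hQ : (0 : ℝ) ≤ A.queryComplexity := Nat.cast_nonneg _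
  -- `1 ≤ 6 · Q · 2s ≤ 48 Q ε`, whence the constant 1/48.
  nlinarith [mul_le_mul_of_nonneg_left hsε4 hQ]
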